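/- Let $\Sigma=\{a,b\}$. A word $w\in\Sigma^*$ is called Sturmian if it is balanced, i.e. if for any two factors (contiguous subwords) $u,v$ of $w$ of the same length and each letter $x\in\Sigma$ one has $\bigl||u|_x-|v|_x\bigr|\le 1$, where $|z|_x$ denotes the number of occurrences of $x$ in $z$. Let $\mathit{St}$ be the set of all Sturmian words. A word $w\in\Sigma^*$ is a minimal forbidden word for $\mathit{St}$ if $w\notin\mathit{St}$ but every proper factor of $w$ (every factor of $w$ other than $w$ itself) belongs to $\mathit{St}$. Then for every integer $n>1$, the number $\mathit{MF}_{\mathit{St}}(n)$ of minimal forbidden words of length $n$ for $\mathit{St}$ is $$\mathit{MF}_{\mathit{St}}(n)=2\bigl(n-1-\phi(n)\bigr),$$ where $\phi$ is Euler's totient function, i.e. $\phi(n)$ is the number of positive integers at most $n$ that are coprime to $n$. -/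

import Mathlib

/-- A word `w` is balanced if any two factors `u`, `v` of `w` of the same length contain the same
number of each letter up to one. -/
def IsBalancedWord {α : Type*} [DecidableEq α] (w : List α) : Prop :=
  ∀ u v : List α, u <:+: w → v <:+: w → u.length = v.length →
    ∀ x : α, |((u.count x : ℕ) : ℤ) - ((v.count x : ℕ) : ℤ)| ≤ 1

/-- The language `St` of (finite) Sturmian words: the balanced words over a two-letter alphabet,
here `Bool`. -/
def sturmianLanguage : Language Bool :=
  {w : List Bool | IsBalancedWord w}

/-- The set `MF_L` of minimal forbidden words for a language `L`: the words that are not in `L`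
while each of their proper factors is. -/
def minimalForbiddenWords {α : Type*} (L : Language α) : Language α :=
  {w : List α | w ∉ L ∧ ∀ v : List α, v <:+: w → v ≠ w → v ∈ L}

/-- `X(n)`, the number of words of length `n` in the language `X`. -/
noncomputable def wordCount {α : Type*} (X : Language α) (n : ℕ) : ℕ :=
  Set.ncard {w : List α | w ∈ X ∧ w.length = n}

/-!
Encode a binary word by its path of prefix counts `S`. Minimality means that the only unbalanced
pairs of factors consist of a prefix and a suffix; up to reversal the prefix of some length `k`
contains at least two more letters `true` than the suffix. For the least such `k`, balance of the
two longest proper factors forces the path, lowered by one at its interior points, to be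
`k`-periodic and almost additive, and minimality of `k` gives `k ∣ n`. Almost additivity then
determines the path: `S i = ⌊i c / n⌋ + 1` for `0 < i < n`, where `c` is the total count.
Conversely the lowest path strictly above the segment from `(0, 0)` to `(n, c)` is unbalanced
when the segment meets an interior lattice point, that is, when `c` and `n` are not coprime, while
its two longest proper factors stay balanced because they also follow a slightly tilted segment.
So there are two words, reversals of each other, for each of the `n - 1 - φ n` positive `c < n`
not coprime to `n`.
-/

/-- Increments of `S` over subintervals of `[a, b]` of equal length differ by at most one. For the
path of prefix counts of a letter in a word, this is balance of a factor with respect to that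
letter. -/
def BalancedOn (S : ℕ → ℤ) (a b : ℕ) : Prop :=
  ∀ i j m : ℕ, a ≤ i → a ≤ j → i + m ≤ b → j + m ≤ b → S (i + m) - S i ≤ S (j + m) - S j + 1

lemma balancedOn_congr {S T : ℕ → ℤ} {a b : ℕ} (h : ∀ i, a ≤ i → i ≤ b → S i = T i) :
    BalancedOn S a b ↔ BalancedOn T a b := by
  refine forall₃_congr fun i j m => forall₄_congr fun hi hj him hjm => ?_
  rw [h i hi (by lia), h j hj (by lia), h (i + m) (by lia) him, h (j + m) (by lia) hjm]

lemma balancedOn_of_affine_bound {S : ℕ → ℤ} {N β γ : ℤ} {a b : ℕ}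
    (h : ∀ t, a ≤ t → t ≤ b → N * (S t - 1) < γ + t * β ∧ γ + t * β ≤ N * S t) :
    BalancedOn S a b := by
  intro i j m hi hj him hjm
  obtain ⟨i₁, i₂⟩ := h i hi (by lia)
  obtain ⟨j₁, -⟩ := h j hj (by lia)
  obtain ⟨im₁, im₂⟩ := h (i + m) (by lia) him
  obtain ⟨jm₁, jm₂⟩ := h (j + m) (by lia) hjm
  have hN : 0 < N := by linarith
  push_cast at im₁ im₂ jm₁ jm₂
  have : N * (S (i + m) - S i) < N * (S (j + m) - S j + 2) := by linarith
  have := lt_of_mul_lt_mul_left this hN.le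
  lia

section PrefixCount

variable {α : Type*} [DecidableEq α]

/-- The number of letters `x` in the prefix of length `i` of `w`, as an integer since differences
of prefix counts are the counts of factors. -/
def prefixCount (x : α) (w : List α) (i : ℕ) : ℤ := (w.take i).count x

@[simp] lemma prefixCount_zero (x : α) (w : List α) : prefixCount x w 0 = 0 := by
  simp [prefixCount]

lemma prefixCount_length (x : α) (w : List α) : prefixCount x w w.length = w.count x := by
  simp [prefixCount]

lemma prefixCount_mono (x : α) (w : List α) : Monotone (prefixCount x w) := fun _ _ hij =>
  Int.ofNat_le.2 ((List.take_sublist_take_left hij).count_le x)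

lemma prefixCount_le (x : α) (w : List α) (i : ℕ) : prefixCount x w i ≤ i :=
  Int.ofNat_le.2 (List.count_le_length.trans (List.length_take_le i w))

lemma prefixCount_succ (x : α) (w : List α) {i : ℕ} (h : i < w.length) :
    prefixCount x w (i + 1) = prefixCount x w i + if w[i] = x then 1 else 0 := by
  rw [prefixCount, prefixCount, List.take_succ_eq_append_getElem h, List.count_append,
    List.count_singleton]
  push_cast
  simp only [beq_iff_eq]

lemma count_take_drop (x : α) (w : List α) (i m : ℕ) :
    (((w.drop i).take m).count x : ℤ) = prefixCount x w (i + m) - prefixCount x w i := by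
  simp [prefixCount, List.take_add, List.count_append]

lemma prefixCount_dropLast (x : α) (w : List α) {i : ℕ} (hi : i ≤ w.length - 1) :
    prefixCount x w.dropLast i = prefixCount x w i := by
  rw [prefixCount, prefixCount, List.dropLast_eq_take, List.take_take, min_eq_left hi]

lemma prefixCount_tail (x : α) (w : List α) (i : ℕ) :
    prefixCount x w.tail i = prefixCount x w (1 + i) - prefixCount x w 1 := by
  rw [← count_take_drop, List.drop_one, prefixCount]

lemma prefixCount_reverse (x : α) (w : List α) (i : ℕ) :
    prefixCount x w.reverse i = prefixCount x w w.length - prefixCount x w (w.length - i) := by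
  have h := congrArg (List.count x) (List.take_append_drop (w.length - i) w)
  rw [List.count_append] at h
  simp only [prefixCount, List.take_reverse, List.count_reverse, List.take_length]
  lia

lemma prefixCount_false (w : List Bool) {i : ℕ} (hi : i ≤ w.length) :
    prefixCount false w i = i - prefixCount true w i := by
  have h := List.count_false_add_count_true (w.take i)
  rw [List.length_take_of_le hi] at h
  rw [prefixCount, prefixCount]
  lia

lemma eq_of_prefixCount_true_eq {v w : List Bool} (hl : v.length = w.length)
    (h : ∀ i ≤ w.length, prefixCount true v i = prefixCount true w i) : v = w := by
  refine List.ext_getElem hl fun i hv hw => ?_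
  have hcount := h (i + 1) hw
  rw [prefixCount_succ true v hv, prefixCount_succ true w hw, h i hw.le, add_right_inj] at hcount
  cases hvi : v[i] <;> cases hwi : w[i] <;> simp [hvi, hwi] at hcount ⊢

end PrefixCount

section BalancedWords

variable {α : Type*}

lemma exists_eq_take_drop_of_isInfix {u w : List α} (h : u <:+: w) :
    ∃ i, i + u.length ≤ w.length ∧ (w.drop i).take u.length = u := by
  obtain ⟨s, t, rfl⟩ := h
  exact ⟨s.length, by simp, by simp⟩

variable [DecidableEq α]

lemma isBalancedWord_iff (w : List α) :
    IsBalancedWord w ↔ ∀ x, BalancedOn (prefixCount x w) 0 w.length := by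
  constructor
  · intro h x i j m _ _ hi hj
    have factor_infix (p : ℕ) : (w.drop p).take m <:+: w :=
      (List.take_prefix _ _).isInfix.trans (List.drop_suffix _ _).isInfix
    have := h _ _ (factor_infix i) (factor_infix j)
      (by simp only [List.length_take, List.length_drop]; lia) x
    rw [count_take_drop, count_take_drop, abs_le] at this
    linarith [this.2]
  · intro h u v hu hv huv x
    obtain ⟨i, hi, hu'⟩ := exists_eq_take_drop_of_isInfix hu
    obtain ⟨j, hj, hv'⟩ := exists_eq_take_drop_of_isInfix hv
    rw [← huv] at hj hv'
    rw [← hu', ← hv', count_take_drop, count_take_drop, abs_le]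
    constructor
    · linarith [h x j i u.length (Nat.zero_le _) (Nat.zero_le _) hj hi]
    · linarith [h x i j u.length (Nat.zero_le _) (Nat.zero_le _) hi hj]

lemma isBalancedWord_dropLast_iff (w : List α) :
    IsBalancedWord w.dropLast ↔ ∀ x, BalancedOn (prefixCount x w) 0 (w.length - 1) := by
  rw [isBalancedWord_iff, List.length_dropLast]
  exact forall_congr' fun x => balancedOn_congr fun i _ hi => prefixCount_dropLast x w hi

lemma isBalancedWord_tail_iff (w : List α) :
    IsBalancedWord w.tail ↔ ∀ x, BalancedOn (prefixCount x w) 1 w.length := by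
  rw [isBalancedWord_iff, List.length_tail]
  refine forall_congr' fun x => ⟨fun h i j m hi hj him hjm => ?_, fun h i j m _ _ him hjm => ?_⟩
  · obtain ⟨i, rfl⟩ := Nat.exists_eq_add_of_le hi
    obtain ⟨j, rfl⟩ := Nat.exists_eq_add_of_le hj
    have := h i j m (Nat.zero_le _) (Nat.zero_le _) (by lia) (by lia)
    simp only [prefixCount_tail, ← add_assoc] at this
    linarith
  · rcases m.eq_zero_or_pos with rfl | hm
    · simp
    have := h (1 + i) (1 + j) m (by lia) (by lia) (by lia) (by lia)
    simp only [prefixCount_tail, ← add_assoc]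
    linarith

lemma forall_balancedOn_prefixCount_iff {w : List Bool} {a b : ℕ} (hb : b ≤ w.length) :
    (∀ x, BalancedOn (prefixCount x w) a b) ↔ BalancedOn (prefixCount true w) a b := by
  refine ⟨fun h => h true, fun h x => ?_⟩
  cases x
  · intro i j m hi hj him hjm
    rw [prefixCount_false w (by lia), prefixCount_false w (by lia), prefixCount_false w (by lia),
      prefixCount_false w (by lia)]
    have := h j i m hj hi hjm him
    push_cast
    linarith
  · exact h

lemma IsBalancedWord.of_isInfix {u w : List α} (h : IsBalancedWord w) (hu : u <:+: w) :
    IsBalancedWord u :=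
  fun _ _ hs ht => h _ _ (hs.trans hu) (ht.trans hu)

lemma IsBalancedWord.reverse {w : List α} (h : IsBalancedWord w) : IsBalancedWord w.reverse := by
  intro u v hu hv huv x
  have infix_of_reverse {s : List α} (hs : s <:+: w.reverse) : s.reverse <:+: w := by
    simpa using List.reverse_infix.2 hs
  simpa using h _ _ (infix_of_reverse hu) (infix_of_reverse hv) (by simpa using huv) x

end BalancedWords

section MinimalForbiddenWords

variable {α : Type*}

lemma mem_minimalForbiddenWords_iff_dropLast_tail {L : Language α} (nil_mem : [] ∈ L)
    (mem_of_isInfix : ∀ u w : List α, u <:+: w → w ∈ L → u ∈ L) (w : List α) :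
    w ∈ minimalForbiddenWords L ↔ w ∉ L ∧ w.dropLast ∈ L ∧ w.tail ∈ L := by
  refine and_congr_right fun hw => ?_
  have hne : w ≠ [] := fun h => hw (h ▸ nil_mem)
  have hlen := List.length_pos_of_ne_nil hne
  constructor
  · refine fun h => ⟨h _ w.dropLast_prefix.isInfix fun e => ?_,
      h _ w.tail_suffix.isInfix fun e => ?_⟩ <;>
    · have := congrArg List.length e
      simp only [List.length_dropLast, List.length_tail] at this
      lia
  · rintro ⟨hdropLast, htail⟩ v ⟨s, t, rfl⟩ hvw
    rcases s with _ | ⟨x, s⟩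
    · have ht : t ≠ [] := by rintro rfl; simp at hvw
      refine mem_of_isInfix _ _ ?_ hdropLast
      rw [List.nil_append, List.dropLast_append_of_ne_nil ht]
      exact (List.prefix_append v _).isInfix
    · exact mem_of_isInfix _ _ ⟨s, t, rfl⟩ htail

lemma minimalForbiddenWords_reverse (L : Language α) :
    minimalForbiddenWords L.reverse = (minimalForbiddenWords L).reverse := by
  ext w
  refine and_congr Iff.rfl ⟨fun h v hv hne => ?_, fun h v hv hne => ?_⟩
  · have := h v.reverse (by simpa using List.reverse_infix.2 hv)
      fun e => hne (by rw [← e, List.reverse_reverse])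
    rwa [Language.mem_reverse, List.reverse_reverse] at this
  · exact h v.reverse (List.reverse_infix.2 hv) (List.reverse_injective.ne hne)

lemma reverse_sturmianLanguage : sturmianLanguage.reverse = sturmianLanguage := by
  ext w
  refine ⟨fun h => ?_, IsBalancedWord.reverse⟩
  have hw := IsBalancedWord.reverse h
  rwa [List.reverse_reverse] at hw

lemma reverse_mem_minimalForbiddenWords_sturmianLanguage {w : List Bool}
    (hw : w ∈ minimalForbiddenWords sturmianLanguage) :
    w.reverse ∈ minimalForbiddenWords sturmianLanguage := by
  rwa [← Language.mem_reverse, ← minimalForbiddenWords_reverse, reverse_sturmianLanguage]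

lemma mem_minimalForbiddenWords_sturmianLanguage_iff (w : List Bool) :
    w ∈ minimalForbiddenWords sturmianLanguage ↔
      ¬ BalancedOn (prefixCount true w) 0 w.length ∧
        BalancedOn (prefixCount true w) 0 (w.length - 1) ∧
        BalancedOn (prefixCount true w) 1 w.length := by
  rw [← forall_balancedOn_prefixCount_iff le_rfl, ← isBalancedWord_iff,
    ← forall_balancedOn_prefixCount_iff (Nat.sub_le _ _), ← isBalancedWord_dropLast_iff,
    ← forall_balancedOn_prefixCount_iff le_rfl, ← isBalancedWord_tail_iff]
  refine mem_minimalForbiddenWords_iff_dropLast_tail ?_ ?_ w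
  · exact (isBalancedWord_iff []).2 fun x i j m _ _ _ _ => by simp [prefixCount]
  · exact fun u w hu hw => IsBalancedWord.of_isInfix hw hu

end MinimalForbiddenWords

section StrictUpperWord

/-- The word of length `n` whose prefix counts of the letter `true` are given by `T`, provided that
`T 0 = 0` and the increments of `T` are `0` or `1`. -/
def wordOfCounts (T : ℕ → ℤ) (n : ℕ) : List Bool :=
  (List.range n).map fun i => decide (T i < T (i + 1))

@[simp] lemma length_wordOfCounts (T : ℕ → ℤ) (n : ℕ) : (wordOfCounts T n).length = n := by
  simp [wordOfCounts]

lemma prefixCount_wordOfCounts {T : ℕ → ℤ} {n : ℕ} (zero : T 0 = 0)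
    (step : ∀ i < n, T i ≤ T (i + 1) ∧ T (i + 1) ≤ T i + 1) {i : ℕ} (hi : i ≤ n) :
    prefixCount true (wordOfCounts T n) i = T i := by
  induction i with
  | zero => simp [zero]
  | succ i ih =>
    rw [prefixCount_succ _ _ (by simpa using hi), ih (by lia)]
    have := step i hi
    simp only [wordOfCounts, List.getElem_map, List.getElem_range, decide_eq_true_eq]
    split_ifs <;> lia

/-- The heights of the lowest lattice path from `(0, 0)` to `(n, c)` whose intermediate points lie
strictly above the segment between these two points. -/
def strictUpperHeight (n c i : ℕ) : ℤ := i * c / n + if 0 < i ∧ i < n then 1 else 0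

/-- The binary word of length `n` coding the path of heights `strictUpperHeight n c`. It is the
lower Christoffel word of slope `c / n` with its first and last letters exchanged, where for `c`
and `n` not coprime the Christoffel word is understood as a power of a shorter one. -/
def strictUpperWord (n c : ℕ) : List Bool := wordOfCounts (strictUpperHeight n c) n

@[simp] lemma length_strictUpperWord (n c : ℕ) : (strictUpperWord n c).length = n :=
  length_wordOfCounts _ _

variable {n c : ℕ}

@[simp] lemma strictUpperHeight_zero (n c : ℕ) : strictUpperHeight n c 0 = 0 := by
  simp [strictUpperHeight]

lemma strictUpperHeight_self (hn : 0 < n) (c : ℕ) : strictUpperHeight n c n = c := by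
  simp [strictUpperHeight, Int.mul_ediv_cancel_left _ (by lia : (n : ℤ) ≠ 0)]

lemma strictUpperHeight_of_mul_eq {i q : ℕ} (hi : 0 < i) (hin : i < n) (h : i * c = n * q) :
    strictUpperHeight n c i = q + 1 := by
  have hq : (i * c : ℤ) = n * q := by exact_mod_cast h
  simp [strictUpperHeight, hi, hin, hq, Int.mul_ediv_cancel_left _ (by lia : (n : ℤ) ≠ 0)]

lemma strictUpperHeight_bounds_of_interior {i : ℕ} (hi : 0 < i) (hin : i < n) :
    n * (strictUpperHeight n c i - 1) ≤ i * c ∧ i * c < n * strictUpperHeight n c i := by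
  have hn : (0 : ℤ) < n := by lia
  have floor_le := Int.mul_ediv_self_le (x := (i * c : ℤ)) hn.ne'
  have lt_floor := Int.lt_mul_ediv_self_add (x := (i * c : ℤ)) hn
  simp only [strictUpperHeight, hi, hin, and_self, if_true]
  constructor <;> linarith

lemma strictUpperHeight_bounds {i : ℕ} (hn : 0 < n) (hin : i ≤ n) :
    n * (strictUpperHeight n c i - 1) ≤ i * c ∧ i * c ≤ n * strictUpperHeight n c i := by
  rcases i.eq_zero_or_pos with rfl | hi
  · simp
  rcases hin.lt_or_eq with hlt | rfl
  · exact (strictUpperHeight_bounds_of_interior hi hlt).imp id le_of_lt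
  · rw [strictUpperHeight_self hn]
    constructor <;> linarith

lemma strictUpperHeight_step (hc : 0 < c) (hcn : c < n) {i : ℕ} (hi : i < n) :
    strictUpperHeight n c i ≤ strictUpperHeight n c (i + 1) ∧
      strictUpperHeight n c (i + 1) ≤ strictUpperHeight n c i + 1 := by
  have hn : (0 : ℤ) ≤ n := by lia
  obtain ⟨lower, upper⟩ := strictUpperHeight_bounds (c := c) (by lia) hi.le
  obtain ⟨lower', upper'⟩ := strictUpperHeight_bounds (c := c) (by lia) hi
  push_cast at lower' upper'
  constructor
  · have : n * (strictUpperHeight n c i - 1) < n * strictUpperHeight n c (i + 1) := by lia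
    have := lt_of_mul_lt_mul_left this hn
    lia
  · have : n * (strictUpperHeight n c (i + 1) - 1) < n * (strictUpperHeight n c i + 1) := by lia
    have := lt_of_mul_lt_mul_left this hn
    lia

lemma prefixCount_strictUpperWord (hc : 0 < c) (hcn : c < n) {i : ℕ} (hi : i ≤ n) :
    prefixCount true (strictUpperWord n c) i = strictUpperHeight n c i :=
  prefixCount_wordOfCounts (strictUpperHeight_zero n c) (fun _ => strictUpperHeight_step hc hcn) hi

lemma count_true_strictUpperWord (hc : 0 < c) (hcn : c < n) :
    (strictUpperWord n c).count true = c := by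
  have h := prefixCount_length true (strictUpperWord n c)
  rw [length_strictUpperWord, prefixCount_strictUpperWord hc hcn le_rfl,
    strictUpperHeight_self (by lia)] at h
  exact_mod_cast h.symm

lemma strictUpperWord_ne_reverse {b : ℕ} (hb : 0 < b) (hbn : b < n) (hc : 0 < c) (hcn : c < n) :
    strictUpperWord n b ≠ (strictUpperWord n c).reverse := by
  intro h
  have hfirst := congrArg (prefixCount true · 1) h
  simp only [prefixCount_reverse, length_strictUpperWord] at hfirst
  rw [prefixCount_strictUpperWord hb hbn (by lia), prefixCount_strictUpperWord hc hcn le_rfl,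
    prefixCount_strictUpperWord hc hcn (by lia), strictUpperHeight_self (by lia)] at hfirst
  have hone := (strictUpperHeight_bounds_of_interior (c := b) one_pos (by lia : 1 < n)).2
  have hlast := (strictUpperHeight_bounds_of_interior (c := c) (by lia)
    (by lia : n - 1 < n)).2
  rw [Nat.cast_sub (by lia)] at hlast
  have : (0 : ℤ) < strictUpperHeight n b 1 :=
    pos_of_mul_pos_right (lt_of_le_of_lt (by positivity) hone) (by positivity)
  have : (n : ℤ) * (c - 1) < n * strictUpperHeight n c (n - 1) := by push_cast at hlast; linarith
  have := lt_of_mul_lt_mul_left this (by positivity)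
  lia

/- Below `n` the heights are also the ceilings along the segment from `(0, 0)` of slope
`c / n + 1 / n ^ 2`, tilted so as to pass above the lattice points of the original segment. -/
lemma balancedOn_strictUpperHeight_left (hn : 0 < n) :
    BalancedOn (strictUpperHeight n c) 0 (n - 1) := by
  refine balancedOn_of_affine_bound (N := n * n) (β := c * n + 1) (γ := 0) fun t _ ht => ?_
  rcases t.eq_zero_or_pos with rfl | ht0
  · simp [hn.ne']
  obtain ⟨lower, upper⟩ := strictUpperHeight_bounds_of_interior (c := c) ht0 (by lia : t < n)
  have lower' := mul_le_mul_of_nonneg_left lower (Nat.cast_nonneg (α := ℤ) n)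
  have upper' := mul_le_mul_of_nonneg_left (Int.add_one_le_of_lt upper)
    (Nat.cast_nonneg (α := ℤ) n)
  constructor <;> lia

/- Here the tilted segment has slope `c / n - 1 / n ^ 2` and ends at `(n, c)`. -/
lemma balancedOn_strictUpperHeight_right (n c : ℕ) : BalancedOn (strictUpperHeight n c) 1 n := by
  refine balancedOn_of_affine_bound (N := n * n) (β := c * n - 1) (γ := n) fun t ht0 ht => ?_
  rcases ht.lt_or_eq with htn | rfl
  · obtain ⟨lower, upper⟩ := strictUpperHeight_bounds_of_interior (c := c) ht0 htn
    have lower' := mul_le_mul_of_nonneg_left lower (Nat.cast_nonneg (α := ℤ) n)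
    have upper' := mul_le_mul_of_nonneg_left (Int.add_one_le_of_lt upper)
      (Nat.cast_nonneg (α := ℤ) n)
    constructor <;> lia
  · rw [strictUpperHeight_self (by lia)]
    constructor <;> nlinarith

lemma not_balancedOn_strictUpperHeight (hn : 0 < n) (hnc : ¬ n.Coprime c) :
    ¬ BalancedOn (strictUpperHeight n c) 0 n := by
  intro h
  obtain ⟨p, hp, ⟨k, rfl⟩, ⟨q, rfl⟩⟩ := Nat.Prime.not_coprime_iff_dvd.1 hnc
  have hk : 0 < k := Nat.pos_of_mul_pos_left hn
  have hkn : k < p * k := lt_mul_of_one_lt_left hk hp.one_lt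
  have hprefix : strictUpperHeight (p * k) (p * q) k = q + 1 :=
    strictUpperHeight_of_mul_eq hk hkn (by ring)
  have hsuffix : strictUpperHeight (p * k) (p * q) (p * k - k) = (p * q - q : ℕ) + 1 :=
    strictUpperHeight_of_mul_eq (by lia) (by lia) (by rw [Nat.mul_sub, Nat.sub_mul]; ring_nf)
  have := h 0 (p * k - k) k le_rfl (Nat.zero_le _) (by lia) (by lia)
  rw [zero_add, Nat.sub_add_cancel hkn.le, hprefix, hsuffix, strictUpperHeight_zero,
    strictUpperHeight_self hn] at this
  lia

lemma strictUpperWord_mem_minimalForbiddenWords (hc : 0 < c) (hcn : c < n)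
    (hnc : ¬ n.Coprime c) :
    strictUpperWord n c ∈ minimalForbiddenWords sturmianLanguage := by
  have transfer {a b : ℕ} (hb : b ≤ n) : BalancedOn (prefixCount true (strictUpperWord n c)) a b ↔
      BalancedOn (strictUpperHeight n c) a b :=
    balancedOn_congr fun i _ hi => prefixCount_strictUpperWord hc hcn (hi.trans hb)
  rw [mem_minimalForbiddenWords_sturmianLanguage_iff, length_strictUpperWord, transfer le_rfl,
    transfer (Nat.sub_le n 1), transfer le_rfl]
  exact ⟨not_balancedOn_strictUpperHeight (by lia) hnc,
    balancedOn_strictUpperHeight_left (by lia), balancedOn_strictUpperHeight_right n c⟩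

end StrictUpperWord

section AlmostAdditive

variable {P : ℕ → ℤ} {n k : ℕ} {q : ℤ}

lemma apply_add_mul_of_apply_add (period : ∀ i, i + k ≤ n → P (i + k) = P i + q) (r a : ℕ)
    (h : r + k * a ≤ n) : P (r + k * a) = P r + a * q := by
  induction a with
  | zero => simp
  | succ a ih =>
    rw [mul_add, mul_one, ← add_assoc] at h ⊢
    rw [period _ h, ih (by lia)]
    push_cast; ring

lemma eq_mul_ediv_of_almost_additive (hk : 0 < k) (zero : P 0 = 0)
    (period : ∀ i, P (i + k) = P i + q) (superadd : ∀ i j, P i + P j ≤ P (i + j))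
    (subadd : ∀ i j, P (i + j) ≤ P i + P j + 1) (i : ℕ) : P i = i * q / k := by
  have apply_mul : P (k * i) = i * q := by
    simpa [zero] using apply_add_mul_of_apply_add (fun j _ => period j) 0 i le_rfl
  have mul_le (t : ℕ) : t * P i ≤ P (t * i) := by
    induction t with
    | zero => simp [zero]
    | succ t ih =>
      rw [add_one_mul t i]
      push_cast
      linarith [superadd (t * i) i]
  have lt_mul {t : ℕ} (ht : 1 ≤ t) : P (t * i) < t * (P i + 1) := by
    induction t, ht using Nat.le_induction with
    | base => simp
    | succ t _ ih =>
      rw [add_one_mul t i]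
      push_cast
      linarith [subadd (t * i) i]
  symm
  rw [Int.ediv_eq_iff_of_pos (by lia), ← apply_mul]
  constructor <;> linarith [mul_le k, lt_mul hk]

lemma eq_mul_ediv_of_almost_additive_of_le (hk : 0 < k) (hkn : 2 * k ≤ n) (zero : P 0 = 0)
    (period : ∀ i, i + k ≤ n → P (i + k) = P i + q)
    (superadd : ∀ i < k, ∀ j < k, P i + P j ≤ P (i + j))
    (subadd : ∀ i < k, ∀ j < k, P (i + j) ≤ P i + P j + 1) {i : ℕ} (hi : i ≤ n) :
    P i = i * q / k := by
  let F (j : ℕ) : ℤ := P (j % k) + (j / k : ℕ) * q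
  have F_eq {j : ℕ} (hj : j ≤ n) : F j = P j := by
    have := apply_add_mul_of_apply_add period (j % k) (j / k) (by rwa [Nat.mod_add_div])
    rw [Nat.mod_add_div] at this
    exact this.symm
  have F_period (j : ℕ) : F (j + k) = F j + q := by
    simp only [F, Nat.add_mod_right, Nat.add_div_right j hk]
    push_cast; ring
  have F_add (a b : ℕ) : F (a + b) = P (a % k + b % k) + ((a / k : ℕ) + (b / k : ℕ)) * q := by
    have ha := Nat.mod_lt a hk
    have hb := Nat.mod_lt b hk
    have := apply_add_mul_of_apply_add (fun j _ => F_period j) (a % k + b % k) (a / k + b / k)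
      le_rfl
    rwa [F_eq (j := a % k + b % k) (by lia), Nat.mul_add, add_add_add_comm, Nat.mod_add_div,
      Nat.mod_add_div, Nat.cast_add] at this
  rw [← F_eq hi]
  refine eq_mul_ediv_of_almost_additive hk ((F_eq (Nat.zero_le n)).trans zero) F_period
    (fun a b => ?_) (fun a b => ?_) i <;> rw [F_add]
  · linarith [superadd _ (Nat.mod_lt a hk) _ (Nat.mod_lt b hk)]
  · linarith [subadd _ (Nat.mod_lt a hk) _ (Nat.mod_lt b hk)]

end AlmostAdditive

/-- A path of prefix counts of a word of length `n`, balanced on the two longest proper factors,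
such that `k` is the least length for which the prefix has an excess of at least two over the
suffix, whose count is `S n - S (n - k)`. -/
structure IsLeastExcess (S : ℕ → ℤ) (n k : ℕ) : Prop where
  zero : S 0 = 0
  mono : Monotone S
  le_self : ∀ i, S i ≤ i
  balanced_left : BalancedOn S 0 (n - 1)
  balanced_right : BalancedOn S 1 n
  le_length : k ≤ n
  excess : S n + 2 ≤ S k + S (n - k)
  minimal : ∀ r < k, S r + S (n - r) < S n + 2

/-- The path `S` lowered by one at its interior points, so that `lowered n S` is the floor function
`i ↦ i * c / n` when `S` is `strictUpperHeight n c`. -/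
def lowered (n : ℕ) (S : ℕ → ℤ) (i : ℕ) : ℤ := S i - if 0 < i ∧ i < n then 1 else 0

lemma lowered_zero (n : ℕ) (S : ℕ → ℤ) : lowered n S 0 = S 0 := by simp [lowered]

lemma lowered_self (n : ℕ) (S : ℕ → ℤ) : lowered n S n = S n := by simp [lowered]

lemma lowered_of_interior {n i : ℕ} (S : ℕ → ℤ) (hi : 0 < i) (hin : i < n) :
    lowered n S i = S i - 1 := by
  simp [lowered, hi, hin]

namespace IsLeastExcess

variable {S : ℕ → ℤ} {n k : ℕ}

lemma two_le_apply (h : IsLeastExcess S n k) : 2 ≤ S k := by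
  linarith [h.excess, h.mono (Nat.sub_le n k)]

lemma two_le (h : IsLeastExcess S n k) : 2 ≤ k := by
  exact_mod_cast h.two_le_apply.trans (h.le_self k)

lemma add_two_le (h : IsLeastExcess S n k) : k + 2 ≤ n := by
  have : 2 ≤ S (n - k) := by linarith [h.excess, h.mono h.le_length]
  have : 2 ≤ ((n - k : ℕ) : ℤ) := this.trans (h.le_self _)
  have := h.le_length
  lia

lemma apply_add_of_lt (h : IsLeastExcess S n k) {i : ℕ} (hi : 0 < i) (hin : i + k < n) :
    S (i + k) = S i + (S k - 1) := by
  have hprefix := h.balanced_left 0 i k le_rfl (Nat.zero_le i) (by lia) (by lia)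
  have hsuffix := h.balanced_right i (n - k) k hi (by lia) hin.le (by lia)
  rw [zero_add, h.zero] at hprefix
  rw [Nat.sub_add_cancel h.le_length] at hsuffix
  linarith [h.excess]

lemma apply_length (h : IsLeastExcess S n k) : S n = S (n - k) + (S k - 2) := by
  have hk := h.add_two_le
  have hsuffix := h.balanced_right 1 (n - k) k le_rfl (by lia) (by lia) (by lia)
  rw [Nat.sub_add_cancel h.le_length, add_comm 1 k] at hsuffix
  have := h.apply_add_of_lt one_pos (by lia)
  rw [add_comm 1 k] at this
  linarith [h.excess]

lemma lowered_add (h : IsLeastExcess S n k) {i : ℕ} (hin : i + k ≤ n) :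
    lowered n S (i + k) = lowered n S i + (S k - 1) := by
  have hk := h.two_le
  have hkn := h.add_two_le
  rcases i.eq_zero_or_pos with rfl | hi
  · rw [zero_add, lowered_zero, h.zero, lowered_of_interior S (by lia) (by lia), zero_add]
  rw [lowered_of_interior S hi (by lia)]
  rcases hin.lt_or_eq with hlt | rfl
  · rw [lowered_of_interior S (by lia) hlt, h.apply_add_of_lt hi hlt]
    ring
  · have := h.apply_length
    rw [Nat.add_sub_cancel] at this
    rw [lowered_self]
    linarith

/- If `k` did not divide `n`, the prefix of length `n % k` would already have an excess of two. -/
lemma dvd (h : IsLeastExcess S n k) : k ∣ n := by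
  have hk := h.two_le
  have hkn := h.add_two_le
  by_contra hdvd
  have hr : 0 < n % k := Nat.pos_of_ne_zero fun e => hdvd (Nat.dvd_of_mod_eq_zero e)
  have hrk : n % k < k := Nat.mod_lt _ (by lia)
  have hdecomp := Nat.mod_add_div n k
  have hprefix := apply_add_mul_of_apply_add (fun i => h.lowered_add) (n % k) (n / k) hdecomp.le
  have hmultiple := apply_add_mul_of_apply_add (fun i => h.lowered_add) 0 (n / k) (by lia)
  rw [hdecomp, lowered_self, lowered_of_interior S hr (by lia)] at hprefix
  rw [zero_add, lowered_of_interior S (by lia) (by lia), lowered_zero, h.zero] at hmultiple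
  have := h.minimal _ hrk
  rw [show n - n % k = k * (n / k) by lia] at this
  linarith

lemma two_mul_le (h : IsLeastExcess S n k) : 2 * k ≤ n := by
  obtain ⟨a, rfl⟩ := h.dvd
  have ha : 1 < a := by
    by_contra! ha
    have := h.add_two_le
    interval_cases a <;> lia
  rw [mul_comm]
  exact Nat.mul_le_mul_left k ha

lemma lowered_add_lowered_le (h : IsLeastExcess S n k) {i j : ℕ} (hi : i < k) (hj : j < k) :
    lowered n S i + lowered n S j ≤ lowered n S (i + j) := by
  have hkn := h.two_mul_le
  rcases i.eq_zero_or_pos with rfl | hi0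
  · simp [lowered_zero, h.zero]
  rcases j.eq_zero_or_pos with rfl | hj0
  · simp [lowered_zero, h.zero]
  rw [lowered_of_interior S hi0 (by lia), lowered_of_interior S hj0 (by lia),
    lowered_of_interior S (by lia) (by lia)]
  have := h.balanced_left 0 i j le_rfl (Nat.zero_le i) (by lia) (by lia)
  rw [zero_add, h.zero] at this
  linarith

lemma lowered_add_le (h : IsLeastExcess S n k) {i j : ℕ} (hi : i < k) (hj : j < k) :
    lowered n S (i + j) ≤ lowered n S i + lowered n S j + 1 := by
  have hkn := h.two_mul_le
  rcases i.eq_zero_or_pos with rfl | hi0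
  · simp [lowered_zero, h.zero]
  rcases j.eq_zero_or_pos with rfl | hj0
  · simp [lowered_zero, h.zero]
  rw [lowered_of_interior S hi0 (by lia), lowered_of_interior S hj0 (by lia),
    lowered_of_interior S (by lia) (by lia)]
  have hshift := h.balanced_right i k j hi0 (one_le_two.trans h.two_le) (by lia) (by lia)
  have hperiod := h.apply_add_of_lt hj0 (by lia)
  rw [add_comm j k] at hperiod
  linarith

lemma exists_eq_strictUpperHeight (h : IsLeastExcess S n k) :
    ∃ c : ℕ, 0 < c ∧ c < n ∧ ¬ n.Coprime c ∧ ∀ i ≤ n, S i = strictUpperHeight n c i := by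
  have hk := h.two_le
  obtain ⟨q, hq⟩ := Int.eq_ofNat_of_zero_le (by linarith [h.two_le_apply] : 0 ≤ S k - 1)
  have hq0 : 0 < q := by have := h.two_le_apply; lia
  have hqk : q < k := by have := h.le_self k; lia
  have floor {i : ℕ} (hi : i ≤ n) : lowered n S i = i * (q : ℤ) / k := by
    rw [← Int.ofNat_eq_natCast, ← hq]
    exact eq_mul_ediv_of_almost_additive_of_le (by lia) h.two_mul_le
      (by rw [lowered_zero, h.zero]) (fun i => h.lowered_add)
      (fun i hi j => h.lowered_add_lowered_le hi) (fun i hi j => h.lowered_add_le hi) hi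
  obtain ⟨a, rfl⟩ := h.dvd
  have ha : 1 < a := by
    have := h.two_mul_le
    by_contra! ha
    interval_cases a <;> lia
  refine ⟨q * a, Nat.mul_pos hq0 (by lia), Nat.mul_lt_mul_of_pos_right hqk (by lia),
    Nat.not_coprime_of_dvd_of_dvd ha (dvd_mul_left a k) (dvd_mul_left a q), fun i hi => ?_⟩
  rw [strictUpperHeight, Nat.cast_mul, Nat.cast_mul, ← mul_assoc,
    Int.mul_ediv_mul_of_pos_left _ _ (by lia), ← floor hi, lowered, sub_add_cancel]

end IsLeastExcess

/-- The prefix of some length contains at least two more letters `true` than the suffix of the same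
length. Up to reversal, this is how a minimal forbidden word violates balance. -/
def HasPrefixExcess (w : List Bool) : Prop :=
  ∃ k ≤ w.length, prefixCount true w w.length + 2 ≤
    prefixCount true w k + prefixCount true w (w.length - k)

lemma HasPrefixExcess.exists_eq_strictUpperWord {w : List Bool} (excess : HasPrefixExcess w)
    (hw : w ∈ minimalForbiddenWords sturmianLanguage) :
    ∃ c : ℕ, 0 < c ∧ c < w.length ∧ ¬ w.length.Coprime c ∧ w = strictUpperWord w.length c := by
  classical
  obtain ⟨-, balanced_left, balanced_right⟩ :=
    (mem_minimalForbiddenWords_sturmianLanguage_iff w).1 hw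
  obtain ⟨hk, hexcess⟩ := Nat.find_spec excess
  have least : IsLeastExcess (prefixCount true w) w.length (Nat.find excess) :=
    ⟨prefixCount_zero true w, prefixCount_mono true w, prefixCount_le true w, balanced_left,
      balanced_right, hk, hexcess, fun r hr =>
        not_le.1 fun hle => Nat.find_min excess hr ⟨hr.le.trans hk, hle⟩⟩
  obtain ⟨c, hc, hcn, hnc, heq⟩ := least.exists_eq_strictUpperHeight
  refine ⟨c, hc, hcn, hnc, (eq_of_prefixCount_true_eq (by simp) fun i hi => ?_).symm⟩
  rw [heq i hi, prefixCount_strictUpperWord hc hcn hi]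

lemma hasPrefixExcess_or_reverse {w : List Bool}
    (hw : w ∈ minimalForbiddenWords sturmianLanguage) :
    HasPrefixExcess w ∨ HasPrefixExcess w.reverse := by
  obtain ⟨unbalanced, balanced_left, balanced_right⟩ :=
    (mem_minimalForbiddenWords_sturmianLanguage_iff w).1 hw
  simp only [BalancedOn, not_forall, not_le] at unbalanced
  obtain ⟨i, j, m, -, -, hi, hj, hlt⟩ := unbalanced
  have ends : (i = 0 ∧ j + m = w.length) ∨ (j = 0 ∧ i + m = w.length) := by
    by_contra! hne
    have : (i + m ≤ w.length - 1 ∧ j + m ≤ w.length - 1) ∨ (1 ≤ i ∧ 1 ≤ j) := by lia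
    rcases this with ⟨hi', hj'⟩ | ⟨hi', hj'⟩
    · linarith [balanced_left i j m (Nat.zero_le i) (Nat.zero_le j) hi' hj']
    · linarith [balanced_right i j m hi' hj' hi hj]
  rcases ends with ⟨rfl, hjm⟩ | ⟨rfl, him⟩
  · refine Or.inl ⟨m, by lia, ?_⟩
    rw [hjm, zero_add, prefixCount_zero] at hlt
    rw [show w.length - m = j by lia]
    linarith
  · refine Or.inr ⟨m, by rw [List.length_reverse]; lia, ?_⟩
    rw [him, zero_add, prefixCount_zero] at hlt
    simp only [prefixCount_reverse, List.length_reverse, Nat.sub_self, prefixCount_zero,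
      show w.length - m = i by lia, show w.length - i = m by lia]
    linarith

/-- The positive integers below `n` that are not coprime to `n`, which index the minimal forbidden
words of length `n` up to reversal. -/
def nonCoprimes (n : ℕ) : Finset ℕ := {c ∈ Finset.Ioo 0 n | ¬ n.Coprime c}

lemma mem_nonCoprimes {n c : ℕ} : c ∈ nonCoprimes n ↔ (0 < c ∧ c < n) ∧ ¬ n.Coprime c := by
  rw [nonCoprimes, Finset.mem_filter, Finset.mem_Ioo]

lemma card_nonCoprimes_add_totient {n : ℕ} (hn : 1 < n) :
    (nonCoprimes n).card + n.totient = n - 1 := by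
  have coprimes : {c ∈ Finset.Ioo 0 n | n.Coprime c} = {c ∈ Finset.range n | n.Coprime c} := by
    ext c
    rcases c.eq_zero_or_pos with rfl | hc
    · simp [hn.ne']
    · simp [hc]
  rw [Nat.totient_eq_card_coprime, ← coprimes, nonCoprimes, add_comm,
    Finset.card_filter_add_card_filter_not, Nat.card_Ioo, Nat.sub_zero]

lemma setOf_minimalForbiddenWords_eq (n : ℕ) :
    {w : List Bool | w ∈ minimalForbiddenWords sturmianLanguage ∧ w.length = n} =
      strictUpperWord n '' nonCoprimes n ∪
        List.reverse '' (strictUpperWord n '' nonCoprimes n) := by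
  ext w
  constructor
  · rintro ⟨hw, rfl⟩
    rcases hasPrefixExcess_or_reverse hw with excess | excess
    · obtain ⟨c, hc, hcn, hnc, heq⟩ := excess.exists_eq_strictUpperWord hw
      exact Or.inl ⟨c, mem_nonCoprimes.2 ⟨⟨hc, hcn⟩, hnc⟩, heq.symm⟩
    · obtain ⟨c, hc, hcn, hnc, heq⟩ := excess.exists_eq_strictUpperWord
        (reverse_mem_minimalForbiddenWords_sturmianLanguage hw)
      rw [List.length_reverse] at hcn hnc heq
      exact Or.inr ⟨w.reverse, ⟨c, mem_nonCoprimes.2 ⟨⟨hc, hcn⟩, hnc⟩, heq.symm⟩,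
        w.reverse_reverse⟩
  · have strictUpper_mem {c : ℕ} (hc : c ∈ nonCoprimes n) :
        strictUpperWord n c ∈ minimalForbiddenWords sturmianLanguage :=
      have ⟨⟨hc0, hcn⟩, hnc⟩ := mem_nonCoprimes.1 hc
      strictUpperWord_mem_minimalForbiddenWords hc0 hcn hnc
    rintro (⟨c, hc, rfl⟩ | ⟨_, ⟨c, hc, rfl⟩, rfl⟩)
    · exact ⟨strictUpper_mem hc, length_strictUpperWord n c⟩
    · exact ⟨reverse_mem_minimalForbiddenWords_sturmianLanguage (strictUpper_mem hc), by simp⟩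

lemma injOn_strictUpperWord (n : ℕ) : Set.InjOn (strictUpperWord n) (nonCoprimes n) := by
  intro b hb c hc h
  obtain ⟨⟨hb0, hbn⟩, -⟩ := mem_nonCoprimes.1 hb
  obtain ⟨⟨hc0, hcn⟩, -⟩ := mem_nonCoprimes.1 hc
  rw [← count_true_strictUpperWord hb0 hbn, h, count_true_strictUpperWord hc0 hcn]

lemma disjoint_strictUpperWord_reverse (n : ℕ) :
    Disjoint (strictUpperWord n '' nonCoprimes n)
      (List.reverse '' (strictUpperWord n '' nonCoprimes n)) := by
  rw [Set.disjoint_left]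
  rintro _ ⟨b, hb, rfl⟩ ⟨_, ⟨c, hc, rfl⟩, h⟩
  obtain ⟨⟨hb0, hbn⟩, -⟩ := mem_nonCoprimes.1 hb
  obtain ⟨⟨hc0, hcn⟩, -⟩ := mem_nonCoprimes.1 hc
  exact strictUpperWord_ne_reverse hb0 hbn hc0 hcn h.symm

theorem mainTheorem5 (n : ℕ) (hn : 1 < n) :
    (wordCount (minimalForbiddenWords sturmianLanguage) n : ℤ)
      = 2 * ((n : ℤ) - 1 - (Nat.totient n : ℤ)) := by
  have finite : (strictUpperWord n '' nonCoprimes n).Finite := (Finset.finite_toSet _).image _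
  rw [wordCount, setOf_minimalForbiddenWords_eq,
    Set.ncard_union_eq (disjoint_strictUpperWord_reverse n) finite (finite.image _),
    Set.ncard_image_of_injective _ List.reverse_injective,
    (injOn_strictUpperWord n).ncard_image, Set.ncard_coe_finset]
  have := card_nonCoprimes_add_totient hn
  lia
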